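/- Let $G$ be a discrete group. A $G$-flow is a compact Hausdorff space on which $G$ acts by homeomorphisms. A non-empty $G$-flow $X$ is minimal if every orbit is dense in $X$. It is proximal if for all $x,y\in X$ there is a net $(g_i)$ in $G$ with $\lim g_i x=\lim g_i y$. A $G$-flow $Y$ is a factor of $X$ if there is an equivariant continuous surjection $X\to Y$, and two $G$-flows are isomorphic if there is an equivariant homeomorphism between them. The universal minimal proximal $G$-flow $\Pi(G)$ is the minimal proximal $G$-flow, unique up to isomorphism, that has every minimal proximal $G$-flow as a factor. A subset $A\subseteq G$ is completely syndetic if for every $n\in\mathbb{N}$ there is a finite subset $F\subseteq G$ with $FA^n=G^n$, where $G$ acts on $G^n$ diagonally by left multiplication. A Boolean subalgebra $\mathfrak{B}$ of the power set $2^G$ is translation invariant if $gA\in\mathfrak{B}$ for all $A\in\mathfrak{B}$ and $g\in G$. In that case its Stone space, that is, the space of ultrafilters on $\mathfrak{B}$ with the topology generated by the sets $\{x : A\in x\}$, $A\in\mathfrak{B}$, carries the left translation action $gx=\{gA : A\in x\}$ of $G$. Theorem. Let $\mathfrak{B}\subseteq 2^G$ be a translation invariant Boolean subalgebra that is maximal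 (with respect to inclusion) among the translation invariant Boolean subalgebras of $2^G$ all of whose non-empty elements are completely syndetic. Then $\Pi(G)$ is isomorphic, as a $G$-flow, to the Stone space of $\mathfrak{B}$. That is, the Stone space of $\mathfrak{B}$ is a minimal proximal $G$-flow that has every minimal proximal $G$-flow as a factor, and every minimal proximal $G$-flow with this universal property is isomorphic to it. -/

import Mathlib

open scoped Pointwise Topology

/-! ### Flows of a discrete group

A discrete group is a group `G` without topology: an action of `G` by homeomorphisms is a
`MulAction` each of whose elements acts continuously. -/

/-- `X` is a `G`-flow: a compact Hausdorff space on which `G` acts by homeomorphisms. -/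
structure IsFlow (G : Type*) (X : Type*) [Group G] [TopologicalSpace X] [MulAction G X] :
    Prop where
  compactSpace : CompactSpace X
  t2Space : T2Space X
  continuousConstSMul : ContinuousConstSMul G X

/-- `X` is proximal: for all points `x`, `y` there is a net `(gᵢ)` in `G` such that `gᵢ x` and
`gᵢ y` converge to a common limit. Nets in `G` are replaced by proper filters on `G`. -/
def IsProximalAction (G : Type*) (X : Type*) [Group G] [TopologicalSpace X] [MulAction G X] :
    Prop :=
  ∀ x y : X, ∃ (l : Filter G) (z : X), l.NeBot ∧
    Filter.Tendsto (fun g : G => g • x) l (𝓝 z) ∧ Filter.Tendsto (fun g : G => g • y) l (𝓝 z)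

/-- A minimal proximal `G`-flow: a non-empty `G`-flow in which every orbit is dense and which is
proximal. -/
structure IsMinimalProximalFlow (G : Type*) (X : Type*) [Group G] [TopologicalSpace X]
    [MulAction G X] : Prop where
  isFlow : IsFlow G X
  nonempty : Nonempty X
  minimal : MulAction.IsMinimal G X
  proximal : IsProximalAction G X

/-- `X` is a factor of `Y`: there is an equivariant continuous surjection `Y → X`. -/
def IsFactorOf (G : Type*) (X Y : Type*) [Group G] [TopologicalSpace X] [MulAction G X]
    [TopologicalSpace Y] [MulAction G Y] : Prop :=
  ∃ f : Y → X, Continuous f ∧ Function.Surjective f ∧ ∀ (g : G) (y : Y), f (g • y) = g • f y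

/-- `X` and `Y` are isomorphic flows: there is an equivariant homeomorphism `X ≃ₜ Y`. -/
def IsIsomorphicFlow (G : Type*) (X Y : Type*) [Group G] [TopologicalSpace X] [MulAction G X]
    [TopologicalSpace Y] [MulAction G Y] : Prop :=
  ∃ e : X ≃ₜ Y, ∀ (g : G) (x : X), e (g • x) = g • e x

universe u v w

/-- `X` is a universal minimal proximal `G`-flow: it is a minimal proximal `G`-flow, and every
minimal proximal `G`-flow (on a type of the universe `w`) is a factor of `X`. -/
structure IsUniversalMinimalProximalFlow (G : Type u) (X : Type v) [Group G]
    [TopologicalSpace X] [MulAction G X] : Prop where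
  isMinimalProximalFlow : IsMinimalProximalFlow G X
  factor : ∀ (Y : Type w) [TopologicalSpace Y] [MulAction G Y],
    IsMinimalProximalFlow G Y → IsFactorOf G Y X

/-! ### Completely syndetic sets -/

/-- `A ⊆ G` is (left) `n`-syndetic: `F Aⁿ = Gⁿ` for some finite `F ⊆ G`, where `G` acts on `Gⁿ`
diagonally by left multiplication. -/
def IsNSyndetic {G : Type*} [Group G] (n : ℕ) (A : Set G) : Prop :=
  ∃ F : Set G, F.Finite ∧ F • {a : Fin n → G | ∀ i, a i ∈ A} = Set.univ

/-- `A ⊆ G` is completely (left) syndetic: it is `n`-syndetic for every `n`. -/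
def IsCompletelySyndetic {G : Type*} [Group G] (A : Set G) : Prop :=
  ∀ n : ℕ, IsNSyndetic n A

/-! ### Stone spaces -/

/-- The Stone space of a Boolean algebra: the set of its ultrafilters. -/
@[ext]
structure StoneSpace (α : Type*) [BooleanAlgebra α] where
  carrier : Set α
  top_mem : ⊤ ∈ carrier
  bot_notMem : ⊥ ∉ carrier
  inf_mem : ∀ {a b : α}, a ∈ carrier → b ∈ carrier → a ⊓ b ∈ carrier
  mem_of_le : ∀ {a b : α}, a ∈ carrier → a ≤ b → b ∈ carrier
  mem_or_compl_mem : ∀ a : α, a ∈ carrier ∨ aᶜ ∈ carrier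

/-- The topology of the Stone space is generated by the sets `{x | a ∈ x}`. -/
instance StoneSpace.instTopologicalSpace (α : Type*) [BooleanAlgebra α] :
    TopologicalSpace (StoneSpace α) :=
  TopologicalSpace.generateFrom (Set.range fun a : α => {x : StoneSpace α | a ∈ x.carrier})

/-- A Boolean subalgebra of `2^G` is translation invariant if it contains `g A` whenever it
contains `A`. -/
def IsTranslationInvariant {G : Type*} [Group G] (B : BooleanSubalgebra (Set G)) : Prop :=
  ∀ (g : G) (A : Set G), A ∈ B → g • A ∈ B

/-- The translation invariant Boolean subalgebras of `2^G`. -/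
structure InvariantSubalgebra (G : Type*) [Group G] where
  toBooleanSubalgebra : BooleanSubalgebra (Set G)
  invariant : IsTranslationInvariant toBooleanSubalgebra

namespace InvariantSubalgebra

variable {G : Type*} [Group G] (B : InvariantSubalgebra G)

/-- The Stone space of a translation invariant Boolean subalgebra of `2^G`. -/
abbrev Stone : Type _ := StoneSpace B.toBooleanSubalgebra

/-- The translate `g A` of an element `A` of `B`, as an element of `B`. -/
def translate (g : G) (A : B.toBooleanSubalgebra) : B.toBooleanSubalgebra :=
  ⟨g • (A : Set G), B.invariant g _ A.2⟩

/-- The action of `G` on the Stone space by left translation: `g x = {g A | A ∈ x}`, that is,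
`A ∈ g x` if and only if `g⁻¹ A ∈ x`. -/
instance instMulActionStone : MulAction G B.Stone where
  smul g x :=
    { carrier := {A | B.translate g⁻¹ A ∈ x.carrier}
      top_mem := by
        have h : B.translate g⁻¹ ⊤ = ⊤ := Subtype.ext Set.smul_set_univ
        simpa only [Set.mem_ofPred_eq, h] using x.top_mem
      bot_notMem := by
        have h : B.translate g⁻¹ ⊥ = ⊥ := Subtype.ext Set.smul_set_empty
        simpa only [Set.mem_ofPred_eq, h] using x.bot_notMem
      inf_mem := by
        intro a b ha hb
        have h : B.translate g⁻¹ (a ⊓ b) = B.translate g⁻¹ a ⊓ B.translate g⁻¹ b :=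
          Subtype.ext Set.smul_set_inter
        simpa only [Set.mem_ofPred_eq, h] using x.inf_mem ha hb
      mem_of_le := by
        intro a b ha hab
        have h : B.translate g⁻¹ a ≤ B.translate g⁻¹ b :=
          Set.smul_set_mono (show (a : Set G) ⊆ b from hab)
        exact x.mem_of_le ha h
      mem_or_compl_mem := by
        intro a
        have h : B.translate g⁻¹ aᶜ = (B.translate g⁻¹ a)ᶜ := Subtype.ext Set.smul_set_compl
        simpa only [Set.mem_ofPred_eq, h] using x.mem_or_compl_mem (B.translate g⁻¹ a) }
  one_smul x := by
    refine StoneSpace.ext (Set.ext fun A => ?_)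
    have h : B.translate (1 : G)⁻¹ A = A := Subtype.ext (by simp [translate])
    change B.translate (1 : G)⁻¹ A ∈ x.carrier ↔ _
    rw [h]
  mul_smul g k x := by
    refine StoneSpace.ext (Set.ext fun A => ?_)
    have h : B.translate (g * k)⁻¹ A = B.translate k⁻¹ (B.translate g⁻¹ A) :=
      Subtype.ext (by simp [translate, mul_smul])
    change B.translate (g * k)⁻¹ A ∈ x.carrier ↔ B.translate k⁻¹ (B.translate g⁻¹ A) ∈ x.carrier
    rw [h]

end InvariantSubalgebra

/-- `B` is a translation invariant Boolean subalgebra of `2^G` all of whose non-empty elements are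
completely syndetic. -/
def IsCompletelySyndeticAlgebra {G : Type*} [Group G] (B : BooleanSubalgebra (Set G)) : Prop :=
  IsTranslationInvariant B ∧ ∀ A ∈ B, A.Nonempty → IsCompletelySyndetic A

/-!
The Stone space `S` of `B` is a minimal proximal flow because its non-empty basic clopen sets come
from `2`-syndetic sets (`InvariantSubalgebra.exists_smul_mem_smul_mem`): any two points can be moved
simultaneously into any non-empty open set.

The heart of the proof is that `S` has no proper minimal proximal extension
(`injective_of_maximal`). Let `π : Z → S` be a morphism from a minimal proximal flow and let `z₀`
be a point over the principal ultrafilter at `1`. Choose an ultrafilter `U` on `Z` that converges to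
`z₀` and contains every dense open set. The sets `{g | ∀ᶠ z in U, g • z ∈ W}`, with `W` open in `Z`,
form a translation invariant Boolean algebra (`returnAlgebra`); it is closed under complements
because `W ∪ interior Wᶜ` is dense and open. It contains `B`, since for `W` clopen the set is
`{g | g • z₀ ∈ W}`. For non-empty `W` the set contains `{g | g • z₀ ∈ W}`, which is completely
syndetic: in a minimal proximal flow every finite set of points can be moved into `W`
(`IsMinimalProximalFlow.exists_smul_mem_of_finite`), and compactness of `Zⁿ` makes finitely many group elements suffice.
By maximality the algebra equals `B`, so that `B` separates the points of `Z`.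

Given a minimal proximal flow `Y`, a minimal subflow `Z` of `S × Y` is again proximal, hence
`Z → S` is an isomorphism and `Y` is a factor of `S`. Uniqueness holds because the only endomorphism
of a minimal proximal flow is the identity (`IsMinimalProximalFlow.eq_id_of_equivariant`).
-/

open Filter Set

/-! ### Minimal and proximal flows -/

section Flows

variable {G : Type*} [Group G] {X : Type*} [TopologicalSpace X] [MulAction G X]
  {Y : Type*} [TopologicalSpace Y] [MulAction G Y]

theorem isProximalAction_iff :
    IsProximalAction G X ↔
      ∀ x y : X, ∃ z : X, ∀ W ∈ 𝓝 z, ∃ g : G, g • x ∈ W ∧ g • y ∈ W := by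
  refine forall₂_congr fun x y => ?_
  constructor
  · rintro ⟨l, z, hl, hx, hy⟩
    exact ⟨z, fun W hW => ((hx.eventually_mem hW).and (hy.eventually_mem hW)).exists⟩
  · rintro ⟨z, hz⟩
    refine ⟨comap (fun g : G => g • x) (𝓝 z) ⊓ comap (fun g : G => g • y) (𝓝 z), z, ?_,
      tendsto_comap.mono_left inf_le_left, tendsto_comap.mono_left inf_le_right⟩
    rw [inf_neBot_iff]
    rintro _ ⟨V, hV, hV'⟩ _ ⟨W, hW, hW'⟩
    obtain ⟨g, hg⟩ := hz _ (inter_mem hV hW)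
    exact ⟨g, hV' hg.1.1, hW' hg.2.2⟩

theorem IsMinimalProximalFlow.exists_smul_mem_smul_mem (hX : IsMinimalProximalFlow G X) (x y : X)
    {W : Set X} (hW : IsOpen W) (hne : W.Nonempty) : ∃ g : G, g • x ∈ W ∧ g • y ∈ W := by
  have := hX.isFlow.continuousConstSMul
  have := hX.minimal
  obtain ⟨z, hz⟩ := isProximalAction_iff.1 hX.proximal x y
  obtain ⟨k, hk⟩ := hW.exists_smul_mem G z hne
  obtain ⟨g, hg⟩ := hz ((k • ·) ⁻¹' W) ((hW.preimage (continuous_const_smul k)).mem_nhds hk)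
  exact ⟨k * g, by simpa [mul_smul] using hg⟩

/-- Proximality of pairs implies proximality of finite sets: if `s` is contracted to `z` along an
ultrafilter on `G` that moves `a` to `b`, then it remains to move `z` and `b` together. -/
theorem IsMinimalProximalFlow.exists_smul_mem_of_finite (hX : IsMinimalProximalFlow G X)
    {s : Set X} (hs : s.Finite) {W : Set X} (hW : IsOpen W) (hne : W.Nonempty) :
    ∃ g : G, ∀ x ∈ s, g • x ∈ W := by
  have := hX.isFlow.continuousConstSMul
  have := hX.isFlow.compactSpace
  obtain ⟨z⟩ := hX.nonempty
  induction s, hs using Set.Finite.induction_on generalizing W with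
  | empty => exact ⟨1, by simp⟩
  | @insert a s _ _ ih =>
    let l : Filter G := (𝓝 z).lift' fun V => {g : G | ∀ x ∈ s, g • x ∈ V}
    have hmono : Monotone fun V : Set X => {g : G | ∀ x ∈ s, g • x ∈ V} :=
      fun V V' h g hg x hx => h (hg x hx)
    have hl : l.NeBot := by
      refine (lift'_neBot_iff hmono).2 fun V hV => ?_
      obtain ⟨V', hV', hV'o, hz⟩ := mem_nhds_iff.1 hV
      obtain ⟨g, hg⟩ := ih hV'o ⟨z, hz⟩
      exact ⟨g, fun x hx => hV' (hg x hx)⟩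
    obtain ⟨b, -, hb⟩ := isCompact_univ.ultrafilter_le_nhds
      ((Ultrafilter.of l).map fun g => g • a) (by simp)
    obtain ⟨h, hhz, hhb⟩ := hX.exists_smul_mem_smul_mem z b hW hne
    have hWo := hW.preimage (continuous_const_smul h)
    have h1 : ∀ᶠ g in (Ultrafilter.of l : Filter G), ∀ x ∈ s, g • x ∈ (h • ·) ⁻¹' W :=
      Ultrafilter.of_le l (mem_lift' (hWo.mem_nhds hhz))
    have h2 : ∀ᶠ g in (Ultrafilter.of l : Filter G), g • a ∈ (h • ·) ⁻¹' W :=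
      hb (hWo.mem_nhds hhb)
    obtain ⟨g, hg1, hg2⟩ := (h1.and h2).exists
    refine ⟨h * g, fun x hx => ?_⟩
    rw [mul_smul]
    rcases hx with rfl | hx
    exacts [hg2, hg1 x hx]

/-- The sets of return times to non-empty open sets in a minimal proximal flow are completely
syndetic. -/
theorem IsMinimalProximalFlow.isCompletelySyndetic (hX : IsMinimalProximalFlow G X) (x : X)
    {W : Set X} (hW : IsOpen W) (hne : W.Nonempty) :
    IsCompletelySyndetic {g : G | g • x ∈ W} := by
  have := hX.isFlow.continuousConstSMul
  have := hX.isFlow.compactSpace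
  intro n
  obtain ⟨t, ht⟩ := (isCompact_univ (X := Fin n → X)).elim_finite_subcover
    (fun g : G => {p : Fin n → X | ∀ i, g • p i ∈ W})
    (fun g => by
      simp only [ofPred_forall]
      exact isOpen_iInter_of_finite fun i =>
        hW.preimage ((continuous_apply i).const_smul g))
    (fun p _ => by
      obtain ⟨g, hg⟩ := hX.exists_smul_mem_of_finite (finite_range p) hW hne
      exact mem_iUnion.2 ⟨g, fun i => hg _ (mem_range_self i)⟩)
  refine ⟨(t : Set G)⁻¹, t.finite_toSet.inv, eq_univ_of_forall fun a => ?_⟩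
  obtain ⟨g, hg, hga⟩ := mem_iUnion₂.1 (ht (mem_univ fun i => a i • x))
  refine mem_smul.2 ⟨g⁻¹, by simpa using hg, g • a, fun i => ?_, by simp⟩
  simpa [mul_smul] using hga i

theorem surjective_of_equivariant [CompactSpace X] [Nonempty X] [T2Space Y]
    [MulAction.IsMinimal G Y] {f : X → Y} (hf : Continuous f)
    (hfe : ∀ (g : G) (x : X), f (g • x) = g • f x) : Function.Surjective f := by
  refine range_eq_univ.1 ((eq_empty_or_univ_of_smul_invariant_closed G
    (isCompact_range hf).isClosed ?_).resolve_left (range_nonempty f).ne_empty)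
  rintro g _ ⟨_, ⟨x, rfl⟩, rfl⟩
  exact ⟨g • x, hfe g x⟩

/-- A minimal proximal flow has no endomorphism other than the identity: moving `x` and `f x` to a
common limit `z` produces a fixed point `z`, and the fixed points form a subflow. -/
theorem IsMinimalProximalFlow.eq_id_of_equivariant (hX : IsMinimalProximalFlow G X) {f : X → X}
    (hf : Continuous f) (hfe : ∀ (g : G) (x : X), f (g • x) = g • f x) (x : X) : f x = x := by
  have := hX.isFlow.t2Space
  have := hX.minimal
  obtain ⟨l, z, hl, hx, hy⟩ := hX.proximal x (f x)
  have hz : f z = z := tendsto_nhds_unique ((hf.tendsto z).comp hx)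
    (by simpa only [Function.comp_def, hfe] using hy)
  have hfix : {y | f y = y} = univ :=
    (eq_empty_or_univ_of_smul_invariant_closed G (isClosed_eq hf continuous_id') (by
      rintro g _ ⟨y, hy, rfl⟩
      simp only [mem_ofPred_eq] at hy ⊢
      rw [hfe, hy])).resolve_left (Set.Nonempty.ne_empty ⟨z, hz⟩)
  exact hfix.ge (mem_univ x)

theorem IsProximalAction.prod [CompactSpace X] [CompactSpace Y] [ContinuousConstSMul G X]
    [ContinuousConstSMul G Y] (hX : IsProximalAction G X) (hY : IsProximalAction G Y) :
    IsProximalAction G (X × Y) := by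
  rw [isProximalAction_iff]
  rintro ⟨x₁, y₁⟩ ⟨x₂, y₂⟩
  obtain ⟨l, a, hl, h₁, h₂⟩ := hX x₁ x₂
  let u := Ultrafilter.of l
  obtain ⟨b₁, -, hb₁⟩ := isCompact_univ.ultrafilter_le_nhds (u.map fun g => g • y₁) (by simp)
  obtain ⟨b₂, -, hb₂⟩ := isCompact_univ.ultrafilter_le_nhds (u.map fun g => g • y₂) (by simp)
  obtain ⟨m, c, hm, k₁, k₂⟩ := hY b₁ b₂
  let v := Ultrafilter.of m
  obtain ⟨d, -, hd⟩ := isCompact_univ.ultrafilter_le_nhds (v.map fun g => g • a) (by simp)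
  refine ⟨(d, c), fun W hW => ?_⟩
  obtain ⟨W', hW', hW'o, hdc⟩ := mem_nhds_iff.1 hW
  have hv : (v : Filter G) ≤ m := Ultrafilter.of_le m
  have hu : (u : Filter G) ≤ l := Ultrafilter.of_le l
  have e₁ : Tendsto (fun g : G => g • (a, b₁)) v (𝓝 (d, c)) :=
    Tendsto.prodMk_nhds hd (k₁.mono_left hv)
  have e₂ : Tendsto (fun g : G => g • (a, b₂)) v (𝓝 (d, c)) :=
    Tendsto.prodMk_nhds hd (k₂.mono_left hv)
  obtain ⟨h, hh₁, hh₂⟩ := ((e₁.eventually_mem (hW'o.mem_nhds hdc)).and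
    (e₂.eventually_mem (hW'o.mem_nhds hdc))).exists
  have f₁ : Tendsto (fun g : G => h • g • (x₁, y₁)) u (𝓝 (h • (a, b₁))) :=
    (Tendsto.prodMk_nhds (h₁.mono_left hu) hb₁).const_smul h
  have f₂ : Tendsto (fun g : G => h • g • (x₂, y₂)) u (𝓝 (h • (a, b₂))) :=
    (Tendsto.prodMk_nhds (h₂.mono_left hu) hb₂).const_smul h
  obtain ⟨g, hg₁, hg₂⟩ := ((f₁.eventually_mem (hW'o.mem_nhds hh₁)).and
    (f₂.eventually_mem (hW'o.mem_nhds hh₂))).exists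
  refine ⟨h * g, hW' ?_, hW' ?_⟩
  · rwa [mul_smul]
  · rwa [mul_smul]

theorem IsProximalAction.of_isClosed (hX : IsProximalAction G X) (M : SubMulAction G X)
    (hM : IsClosed (M : Set X)) : IsProximalAction G M := by
  intro x y
  obtain ⟨l, z, hl, hx, hy⟩ := hX x y
  have hz : z ∈ M := hM.mem_of_tendsto hx (Eventually.of_forall fun g => M.smul_mem g x.2)
  exact ⟨l, ⟨z, hz⟩, hl, tendsto_subtype_rng.2 hx, tendsto_subtype_rng.2 hy⟩

theorem IsFlow.of_isClosed (hX : IsFlow G X) (M : SubMulAction G X)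
    (hM : IsClosed (M : Set X)) : IsFlow G M := by
  have := hX.compactSpace
  have := hX.t2Space
  have := hX.continuousConstSMul
  exact ⟨isCompact_iff_compactSpace.1 hM.isCompact, inferInstanceAs (T2Space (M : Set X)),
    ⟨fun g => (continuous_subtype_val.const_smul g).subtype_mk _⟩⟩

theorem exists_minimal_subflow [CompactSpace X] [Nonempty X] [ContinuousConstSMul G X] :
    ∃ M : SubMulAction G X, IsClosed (M : Set X) ∧ Nonempty M ∧ MulAction.IsMinimal G M := by
  let S : Set (Set X) := {s | IsClosed s ∧ s.Nonempty ∧ ∀ g : G, ∀ x ∈ s, g • x ∈ s}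
  obtain ⟨m, -, hm⟩ := zorn_superset_nonempty S (fun c hc hchain hne =>
    ⟨⋂₀ c, ⟨isClosed_sInter fun s hs => (hc hs).1, by
      have := hne.to_subtype
      exact IsCompact.nonempty_sInter_of_directed_nonempty_isCompact_isClosed
        (fun s hs t ht => (hchain.total hs ht).elim (fun h => ⟨s, hs, Subset.rfl, h⟩)
          fun h => ⟨t, ht, h, Subset.rfl⟩)
        (fun s hs => (hc hs).2.1) (fun s hs => (hc hs).1.isCompact) (fun s hs => (hc hs).1),
      fun g x hx s hs => (hc hs).2.2 g x (hx s hs)⟩, fun s hs => sInter_subset_of_mem hs⟩)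
    univ ⟨isClosed_univ, univ_nonempty, fun _ _ _ => mem_univ _⟩
  obtain ⟨hcl, hne, hinv⟩ := hm.prop
  refine ⟨⟨m, fun g {x} hx => hinv g x hx⟩, hcl, hne.to_subtype, ⟨fun x => ?_⟩⟩
  have horb : closure (MulAction.orbit G (x : X)) ∈ S :=
    ⟨isClosed_closure, (MulAction.nonempty_orbit _).closure, fun g y hy =>
      smul_closure_orbit_subset g (x : X) (smul_mem_smul_set hy)⟩
  have hle : closure (MulAction.orbit G (x : X)) ⊆ m :=
    closure_minimal (range_subset_iff.2 fun g => hinv g x x.2) hcl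
  intro y
  rw [closure_subtype]
  have himg : (Subtype.val '' MulAction.orbit G x : Set X) = MulAction.orbit G (x : X) := by
    rw [MulAction.orbit, ← range_comp]
    rfl
  rw [himg]
  exact hm.le_of_le horb hle y.2

/-- Two minimal proximal flows have a common minimal proximal extension, namely any minimal subflow
of their product. -/
theorem IsMinimalProximalFlow.exists_joining (hX : IsMinimalProximalFlow G X)
    (hY : IsMinimalProximalFlow G Y) :
    ∃ M : SubMulAction G (X × Y), IsMinimalProximalFlow G M := by
  have := hX.isFlow.compactSpace
  have := hX.isFlow.t2Space
  have := hX.isFlow.continuousConstSMul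
  have := hX.nonempty
  have := hY.isFlow.compactSpace
  have := hY.isFlow.t2Space
  have := hY.isFlow.continuousConstSMul
  have := hY.nonempty
  obtain ⟨M, hM, hne, hmin⟩ := exists_minimal_subflow (G := G) (X := X × Y)
  have hflow : IsFlow G (X × Y) := ⟨inferInstance, inferInstance, inferInstance⟩
  exact ⟨M, hflow.of_isClosed M hM, hne, hmin, (hX.proximal.prod hY.proximal).of_isClosed M hM⟩

end Flows

/-! ### The Stone space as a flow -/

namespace StoneSpace

variable {α : Type*} [BooleanAlgebra α]

theorem compl_mem_iff (x : StoneSpace α) (a : α) : aᶜ ∈ x.carrier ↔ a ∉ x.carrier := by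
  refine ⟨fun h h' => x.bot_notMem ?_, (x.mem_or_compl_mem a).resolve_left⟩
  simpa using x.inf_mem h' h

theorem isClopen_setOf_mem (a : α) : IsClopen {x : StoneSpace α | a ∈ x.carrier} := by
  have ho (b : α) : IsOpen {x : StoneSpace α | b ∈ x.carrier} :=
    TopologicalSpace.isOpen_generateFrom_of_mem (mem_range_self b)
  refine ⟨⟨?_⟩, ho a⟩
  convert! ho aᶜ using 1
  ext x
  exact (x.compl_mem_iff a).symm

instance : T2Space (StoneSpace α) := by
  refine ⟨fun x y hxy => ?_⟩
  obtain ⟨a, ha⟩ : ∃ a, ¬(a ∈ x.carrier ↔ a ∈ y.carrier) := by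
    by_contra! h
    exact hxy (StoneSpace.ext (Set.ext h))
  have hc := isClopen_setOf_mem a
  by_cases hx : a ∈ x.carrier
  · exact ⟨_, _, hc.isOpen, hc.compl.isOpen, hx, fun hy => ha (iff_of_true hx hy),
      disjoint_compl_right⟩
  · exact ⟨_, _, hc.compl.isOpen, hc.isOpen, hx, by_contra fun hy => ha (iff_of_false hx hy),
      disjoint_compl_left⟩

instance : CompactSpace (StoneSpace α) := by
  refine ⟨isCompact_iff_ultrafilter_le_nhds.2 fun f _ => ?_⟩
  let x : StoneSpace α :=
    { carrier := {a | ∀ᶠ y in (f : Filter (StoneSpace α)), a ∈ y.carrier}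
      top_mem := Eventually.of_forall fun y => y.top_mem
      bot_notMem := fun h => h.exists.elim fun y hy => y.bot_notMem hy
      inf_mem := fun ha hb => (ha.and hb).mono fun y hy => y.inf_mem hy.1 hy.2
      mem_of_le := fun ha hab => ha.mono fun y hy => y.mem_of_le hy hab
      mem_or_compl_mem := fun a =>
        Ultrafilter.eventually_or.1 (Eventually.of_forall fun y => y.mem_or_compl_mem a) }
  refine ⟨x, mem_univ x, ?_⟩
  rw [TopologicalSpace.nhds_generateFrom]
  refine le_iInf₂ fun s hs => ?_
  obtain ⟨hx, a, rfl⟩ := hs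
  exact le_principal_iff.2 hx

theorem exists_subset_of_isOpen {W : Set (StoneSpace α)} (hW : IsOpen W) {x : StoneSpace α}
    (hx : x ∈ W) : ∃ a ∈ x.carrier, {y : StoneSpace α | a ∈ y.carrier} ⊆ W := by
  have hbasis := TopologicalSpace.isTopologicalBasis_of_subbasis_of_inter
    (r := Set.range fun a : α => {x : StoneSpace α | a ∈ x.carrier}) rfl (by
      rintro _ ⟨a, rfl⟩ _ ⟨b, rfl⟩
      refine ⟨a ⊓ b, Set.ext fun y => ⟨fun h => ?_, fun h => y.inf_mem h.1 h.2⟩⟩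
      exact ⟨y.mem_of_le h inf_le_left, y.mem_of_le h inf_le_right⟩)
  obtain ⟨_, rfl | ⟨a, rfl⟩, hxa, ha⟩ := hbasis.exists_subset_of_mem_open hx hW
  · exact ⟨⊤, x.top_mem, fun y _ => ha (mem_univ y)⟩
  · exact ⟨a, hxa, ha⟩

end StoneSpace

namespace InvariantSubalgebra

variable {G : Type*} [Group G] (B : InvariantSubalgebra G)

theorem isFlow_stone : IsFlow G B.Stone := by
  refine ⟨inferInstance, inferInstance, ⟨fun g => continuous_generateFrom_iff.2 ?_⟩⟩
  rintro _ ⟨A, rfl⟩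
  exact (StoneSpace.isClopen_setOf_mem (B.translate g⁻¹ A)).isOpen

/-- The principal ultrafilter of `B` at `1`. -/
def principal : B.Stone where
  carrier := {A | (1 : G) ∈ (A : Set G)}
  top_mem := mem_univ (1 : G)
  bot_notMem := notMem_empty (1 : G)
  inf_mem ha hb := ⟨ha, hb⟩
  mem_of_le ha hab := hab ha
  mem_or_compl_mem A := em ((1 : G) ∈ (A : Set G))

theorem mem_smul_principal (g : G) (A : B.toBooleanSubalgebra) :
    A ∈ (g • B.principal).carrier ↔ g ∈ (A : Set G) := by
  change (1 : G) ∈ g⁻¹ • (A : Set G) ↔ _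
  simp [mem_inv_smul_set_iff]

theorem nonempty_of_mem {x : B.Stone} {A : B.toBooleanSubalgebra} (hA : A ∈ x.carrier) :
    (A : Set G).Nonempty := by
  rw [nonempty_iff_ne_empty]
  intro h
  exact x.bot_notMem ((show A = ⊥ from Subtype.ext h) ▸ hA)

theorem denseRange_smul_principal : DenseRange fun g : G => g • B.principal := by
  intro x
  refine mem_closure_iff.2 fun W hW hx => ?_
  obtain ⟨A, hA, hAW⟩ := StoneSpace.exists_subset_of_isOpen hW hx
  obtain ⟨g, hg⟩ := B.nonempty_of_mem hA
  exact ⟨g • B.principal, hAW ((B.mem_smul_principal g A).2 hg), g, rfl⟩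

/-- If `F A² = G²` with `F` finite, then the closed set `⋃ f ∈ F, f Â × f Â`, where `Â` is the
clopen set of `A`, contains a dense subset of the square of the Stone space, hence is everything. -/
theorem exists_smul_mem_smul_mem {A : B.toBooleanSubalgebra}
    (hA : IsNSyndetic 2 (A : Set G)) (x y : B.Stone) :
    ∃ g : G, A ∈ (g • x).carrier ∧ A ∈ (g • y).carrier := by
  obtain ⟨F, hF, hFA⟩ := hA
  have := B.isFlow_stone.continuousConstSMul
  suffices h : ∃ f ∈ F, A ∈ (f⁻¹ • x).carrier ∧ A ∈ (f⁻¹ • y).carrier by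
    obtain ⟨f, -, hf⟩ := h
    exact ⟨f⁻¹, hf⟩
  have hc := (StoneSpace.isClopen_setOf_mem A).isClosed
  refine (B.denseRange_smul_principal.prodMap B.denseRange_smul_principal).induction_on
    (p := fun q : B.Stone × B.Stone =>
      ∃ f ∈ F, A ∈ (f⁻¹ • q.1).carrier ∧ A ∈ (f⁻¹ • q.2).carrier) (x, y) ?_ ?_
  · have heq : {q : B.Stone × B.Stone |
        ∃ f ∈ F, A ∈ (f⁻¹ • q.1).carrier ∧ A ∈ (f⁻¹ • q.2).carrier} =
        ⋃ f ∈ F, {q | A ∈ (f⁻¹ • q.1).carrier ∧ A ∈ (f⁻¹ • q.2).carrier} := by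
      ext q
      simp only [mem_iUnion, mem_ofPred_eq, exists_prop]
    rw [heq]
    exact hF.isClosed_biUnion fun f _ =>
      (hc.preimage (continuous_fst.const_smul f⁻¹)).inter
        (hc.preimage (continuous_snd.const_smul f⁻¹))
  · rintro ⟨g, h⟩
    obtain ⟨f, hf, a, ha, hfa⟩ := mem_smul.1 (hFA.ge (mem_univ ![g, h]))
    have h0 : f * a 0 = g := congrFun hfa 0
    have h1 : f * a 1 = h := congrFun hfa 1
    refine ⟨f, hf, ?_, ?_⟩
    · change A ∈ (f⁻¹ • g • B.principal).carrier
      rw [← mul_smul, mem_smul_principal, ← h0, inv_mul_cancel_left]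
      exact ha 0
    · change A ∈ (f⁻¹ • h • B.principal).carrier
      rw [← mul_smul, mem_smul_principal, ← h1, inv_mul_cancel_left]
      exact ha 1

theorem isMinimalProximalFlow_stone (hB : IsCompletelySyndeticAlgebra B.toBooleanSubalgebra) :
    IsMinimalProximalFlow G B.Stone := by
  have key (x y : B.Stone) (W : Set B.Stone) (hW : IsOpen W) (hne : W.Nonempty) :
      ∃ g : G, g • x ∈ W ∧ g • y ∈ W := by
    obtain ⟨z, hz⟩ := hne
    obtain ⟨A, hA, hAW⟩ := StoneSpace.exists_subset_of_isOpen hW hz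
    obtain ⟨g, hx, hy⟩ := B.exists_smul_mem_smul_mem (hB.2 A A.2 (B.nonempty_of_mem hA) 2) x y
    exact ⟨g, hAW hx, hAW hy⟩
  refine ⟨B.isFlow_stone, ⟨B.principal⟩, ⟨fun x y => mem_closure_iff.2 fun W hW hy => ?_⟩,
    isProximalAction_iff.2 fun x y => ⟨x, fun W hW => ?_⟩⟩
  · obtain ⟨g, hg, -⟩ := key x x W hW ⟨y, hy⟩
    exact ⟨g • x, hg, g, rfl⟩
  · obtain ⟨V, hVW, hV, hxV⟩ := mem_nhds_iff.1 hW
    obtain ⟨g, hg₁, hg₂⟩ := key x y V hV ⟨x, hxV⟩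
    exact ⟨g, hVW hg₁, hVW hg₂⟩

end InvariantSubalgebra

/-! ### The algebra of return sets along a generic ultrafilter -/

section ReturnAlgebra

variable {G : Type*} [Group G] {Z : Type*} [TopologicalSpace Z] [MulAction G Z]

variable (G) in
/-- The set of the elements of `G` that move `U`-almost every point of `Z` into `W`. -/
def returnSet (U : Ultrafilter Z) (W : Set Z) : Set G :=
  {g | ∀ᶠ z in (U : Filter Z), g • z ∈ W}

/-- An ultrafilter containing the dense open sets does not distinguish the complement of an open
set from the interior of that complement. -/
theorem returnSet_interior_compl [ContinuousConstSMul G Z] {U : Ultrafilter Z}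
    (hU : (U : Filter Z) ≤ residual Z) {W : Set Z} (hW : IsOpen W) :
    returnSet G U (interior Wᶜ) = (returnSet G U W)ᶜ := by
  ext g
  have hdense : Dense (W ∪ interior Wᶜ) := by
    rw [interior_compl]
    exact fun z => (em (z ∈ closure W)).elim (fun h => closure_mono subset_union_left h)
      fun h => subset_closure (Or.inr h)
  have hmem : ∀ᶠ z in (U : Filter Z), g • z ∈ W ∪ interior Wᶜ :=
    hU (residual_of_dense_open
      ((hW.union isOpen_interior).preimage (continuous_const_smul g))
      (hdense.preimage (isOpenMap_smul g)))
  change (∀ᶠ z in (U : Filter Z), g • z ∈ interior Wᶜ) ↔ ¬∀ᶠ z in (U : Filter Z), g • z ∈ W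
  rw [← Ultrafilter.eventually_not]
  constructor
  · exact fun h => h.mono fun z hz => interior_subset hz
  · intro h
    filter_upwards [h, hmem] with z hz hz'
    exact hz'.resolve_left hz

variable (G) in
/-- The Boolean algebra of the return sets to open sets along an ultrafilter that contains every
residual set. -/
def returnAlgebra [ContinuousConstSMul G Z]
    (U : Ultrafilter Z) (hU : (U : Filter Z) ≤ residual Z) : BooleanSubalgebra (Set G) where
  carrier := {A | ∃ W : Set Z, IsOpen W ∧ returnSet G U W = A}
  supClosed' := by
    rintro _ ⟨V, hV, rfl⟩ _ ⟨W, hW, rfl⟩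
    exact ⟨V ∪ W, hV.union hW, Set.ext fun g => Ultrafilter.eventually_or⟩
  infClosed' := by
    rintro _ ⟨V, hV, rfl⟩ _ ⟨W, hW, rfl⟩
    exact ⟨V ∩ W, hV.inter hW, Set.ext fun g => eventually_and⟩
  compl_mem' := by
    rintro _ ⟨W, hW, rfl⟩
    exact ⟨interior Wᶜ, isOpen_interior, returnSet_interior_compl hU hW⟩
  bot_mem' := ⟨∅, isOpen_empty, eq_empty_of_forall_notMem fun _ hg => hg.exists.elim fun _ hz => hz⟩

theorem mem_returnSet_of_smul_mem [ContinuousConstSMul G Z] {U : Ultrafilter Z} {z₀ : Z}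
    (hU : (U : Filter Z) ≤ 𝓝 z₀) {W : Set Z} (hW : IsOpen W) {g : G} (hg : g • z₀ ∈ W) :
    g ∈ returnSet G U W :=
  hU ((hW.preimage (continuous_const_smul g)).mem_nhds hg)

theorem notMem_returnSet_of_smul_mem [ContinuousConstSMul G Z] {U : Ultrafilter Z} {z₀ : Z}
    (hU : (U : Filter Z) ≤ 𝓝 z₀) {V W : Set Z} (hV : IsOpen V) (hVW : Disjoint W V) {g : G}
    (hg : g • z₀ ∈ V) : g ∉ returnSet G U W := by
  intro hW
  obtain ⟨z, hz⟩ := (hW.and (mem_returnSet_of_smul_mem hU hV hg)).exists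
  exact hVW.notMem_of_mem_left hz.1 hz.2

theorem IsCompletelySyndetic.mono {A A' : Set G} (hA : IsCompletelySyndetic A) (h : A ⊆ A') :
    IsCompletelySyndetic A' := by
  intro n
  obtain ⟨F, hF, hFA⟩ := hA n
  exact ⟨F, hF, univ_subset_iff.1 (hFA.ge.trans (smul_subset_smul_left fun a ha i => h (ha i)))⟩

theorem IsMinimalProximalFlow.isCompletelySyndeticAlgebra_returnAlgebra
    (hZ : IsMinimalProximalFlow G Z) [ContinuousConstSMul G Z] {U : Ultrafilter Z}
    (hU : (U : Filter Z) ≤ residual Z) {z₀ : Z} (hz₀ : (U : Filter Z) ≤ 𝓝 z₀) :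
    IsCompletelySyndeticAlgebra (returnAlgebra G U hU) := by
  constructor
  · rintro h _ ⟨W, hW, rfl⟩
    refine ⟨h • W, hW.smul h, Set.ext fun g => ?_⟩
    simp [returnSet, mem_smul_set_iff_inv_smul_mem, mul_smul]
  · rintro _ ⟨W, hW, rfl⟩ ⟨g, hg⟩
    obtain ⟨z, hz⟩ := Eventually.exists hg
    exact (hZ.isCompletelySyndetic z₀ hW ⟨_, hz⟩).mono
      fun k hk => mem_returnSet_of_smul_mem hz₀ hW hk

end ReturnAlgebra

/-! ### Universality of the Stone space -/

/-- The Stone space of a maximal completely syndetic algebra has no proper minimal proximal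
extension. -/
theorem injective_of_maximal {G : Type*} [Group G] {B : InvariantSubalgebra G}
    (hB : Maximal IsCompletelySyndeticAlgebra B.toBooleanSubalgebra) {Z : Type*}
    [TopologicalSpace Z] [MulAction G Z] (hZ : IsMinimalProximalFlow G Z) {π : Z → B.Stone}
    (hπ : Continuous π) (hπe : ∀ (g : G) (z : Z), π (g • z) = g • π z) :
    Function.Injective π := by
  have := hZ.isFlow.compactSpace
  have := hZ.isFlow.t2Space
  have := hZ.isFlow.continuousConstSMul
  have := hZ.nonempty
  have := hZ.minimal
  have := (B.isMinimalProximalFlow_stone hB.prop).minimal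
  obtain ⟨z₀, hz₀⟩ := surjective_of_equivariant hπ hπe B.principal
  have hclopen (A : B.toBooleanSubalgebra) : IsClopen {z | A ∈ (π z).carrier} :=
    (StoneSpace.isClopen_setOf_mem A).preimage hπ
  have hmem (g : G) (A : B.toBooleanSubalgebra) :
      A ∈ (π (g • z₀)).carrier ↔ g ∈ (A : Set G) := by
    rw [hπe, hz₀, B.mem_smul_principal]
  -- By the Baire category theorem there is an ultrafilter converging to `z₀` through residual sets.
  have hne : (𝓝 z₀ ⊓ residual Z).NeBot := inf_neBot_iff.2 fun s hs t ht =>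
    inter_comm t s ▸ (dense_of_mem_residual ht).inter_nhds_nonempty hs
  let U := Ultrafilter.of (𝓝 z₀ ⊓ residual Z)
  have hU₀ : (U : Filter Z) ≤ 𝓝 z₀ := (Ultrafilter.of_le _).trans inf_le_left
  have hU : (U : Filter Z) ≤ residual Z := (Ultrafilter.of_le _).trans inf_le_right
  have hle : B.toBooleanSubalgebra ≤ returnAlgebra G U hU := by
    intro A hA
    refine ⟨_, (hclopen ⟨A, hA⟩).isOpen, Set.ext fun g => ?_⟩
    refine ⟨fun hg => by_contra fun hgA => ?_, fun hg =>
      mem_returnSet_of_smul_mem hU₀ (hclopen ⟨A, hA⟩).isOpen ((hmem g ⟨A, hA⟩).2 hg)⟩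
    exact notMem_returnSet_of_smul_mem hU₀ (hclopen ⟨A, hA⟩).compl.isOpen disjoint_compl_right
      (fun h => hgA ((hmem g ⟨A, hA⟩).1 h)) hg
  have hge := hB.le_of_ge (hZ.isCompletelySyndeticAlgebra_returnAlgebra hU hU₀) hle
  intro z₁ z₂ hz
  by_contra hne
  obtain ⟨W, V, hW, hV, hz₁, hz₂, hWV⟩ := t2_separation hne
  let A : B.toBooleanSubalgebra := ⟨returnSet G U W, hge ⟨W, hW, rfl⟩⟩
  by_cases hA : A ∈ (π z₁).carrier
  · obtain ⟨g, hgV, hgA⟩ := (hV.inter (hclopen A).isOpen).exists_smul_mem G z₀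
      ⟨z₂, hz₂, show A ∈ (π z₂).carrier from hz ▸ hA⟩
    exact notMem_returnSet_of_smul_mem hU₀ hV hWV hgV ((hmem g A).1 hgA)
  · obtain ⟨g, hgW, hgA⟩ := (hW.inter (hclopen A).compl.isOpen).exists_smul_mem G z₀
      ⟨z₁, hz₁, hA⟩
    exact hgA ((hmem g A).2 (mem_returnSet_of_smul_mem hU₀ hW hgW))

theorem isFactorOf_stone_of_maximal {G : Type*} [Group G] {B : InvariantSubalgebra G}
    (hB : Maximal IsCompletelySyndeticAlgebra B.toBooleanSubalgebra) {Y : Type*}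
    [TopologicalSpace Y] [MulAction G Y] (hY : IsMinimalProximalFlow G Y) :
    IsFactorOf G Y B.Stone := by
  have hS := B.isMinimalProximalFlow_stone hB.prop
  obtain ⟨M, hM⟩ := hS.exists_joining hY
  have := hM.isFlow.compactSpace
  have := hM.nonempty
  have := hS.minimal
  have := hY.minimal
  have := hY.isFlow.t2Space
  have hc₁ : Continuous fun m : M => (m : B.Stone × Y).1 :=
    continuous_fst.comp continuous_subtype_val
  have hc₂ : Continuous fun m : M => (m : B.Stone × Y).2 :=
    continuous_snd.comp continuous_subtype_val
  have hinj := injective_of_maximal hB hM hc₁ fun _ _ => rfl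
  have hsurj := surjective_of_equivariant (G := G) hc₁ fun _ _ => rfl
  let e := (hc₁.isClosedEmbedding hinj).isEmbedding.toHomeomorphOfSurjective hsurj
  refine ⟨fun x => ((e.symm x : M) : B.Stone × Y).2, hc₂.comp e.symm.continuous,
    (surjective_of_equivariant (G := G) hc₂ fun _ _ => rfl).comp e.symm.surjective,
    fun g x => ?_⟩
  have he : e.symm (g • x) = g • e.symm x := by
    rw [e.symm_apply_eq]
    change g • x = g • e (e.symm x)
    rw [e.apply_symm_apply]
  change ((e.symm (g • x) : M) : B.Stone × Y).2 = _
  rw [he]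
  rfl

theorem mainTheorem1 {G : Type u} [Group G] (B : InvariantSubalgebra G)
    (hB : Maximal IsCompletelySyndeticAlgebra B.toBooleanSubalgebra) :
    IsUniversalMinimalProximalFlow.{u, u, w} G B.Stone ∧
      ∀ (P : Type v) [TopologicalSpace P] [MulAction G P],
        IsUniversalMinimalProximalFlow.{u, v, u} G P → IsIsomorphicFlow G P B.Stone := by
  have hS := B.isMinimalProximalFlow_stone hB.prop
  refine ⟨⟨hS, fun Y _ _ hY => isFactorOf_stone_of_maximal hB hY⟩, fun P _ _ hP => ?_⟩
  obtain ⟨f, hf, -, hfe⟩ := hP.factor B.Stone hS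
  obtain ⟨h, hh, -, hhe⟩ := isFactorOf_stone_of_maximal hB hP.isMinimalProximalFlow
  refine ⟨⟨⟨f, h, fun p => ?_, fun x => ?_⟩, hf, hh⟩, hfe⟩
  · exact hP.isMinimalProximalFlow.eq_id_of_equivariant (hh.comp hf)
      (fun g p => by simp only [Function.comp_apply, hfe, hhe]) p
  · exact hS.eq_id_of_equivariant (hf.comp hh)
      (fun g x => by simp only [Function.comp_apply, hfe, hhe]) x
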